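/- Let $(\Omega,\mathbb B(\Omega),\mu,T)$ be a measure-preserving dynamical system: $\Omega$ is a non-empty topological space, $\mathbb B(\Omega)$ its Borel $\sigma$-algebra, $\mu$ a probability measure on $\mathbb B(\Omega)$, and $T:\Omega\to\Omega$ a measurable $\mu$-preserving map. All partitions are by measurable sets. For a finite partition $\mathcal P=\{P_0,\dots,P_l\}$ of $\Omega$, let $\mathcal P_n$ be the partition into the sets $P_{a_0\ldots a_{n-1}}=\bigcap_{j=0}^{n-1}T^{-j}(P_{a_j})$, and put (with $0\ln 0:=0$) $$H(\mathcal P)=-\sum_{P\in\mathcal P}\mu(P)\ln\mu(P),\qquad h_\mu(T,\mathcal P)=\lim_{n\to\infty}\bigl(H(\mathcal P_{n+1})-H(\mathcal P_n)\bigr),\qquad h_\mu(T)=\sup_{\mathcal P\text{ finite partition}}h_\mu(T,\mathcal P)\in[0,\infty].$$ A vector $(x_0,\dots,x_d)\in\mathbb R^{d+1}$ has the ordinal pattern $(r_0,\dots,r_d)$, a permutation of $\{0,\dots,d\}$, if $x_{r_0}\ge x_{r_1}\ge\dots\ge x_{r_d}$ and $r_{l-1}>r_l$ whenever $x_{r_{l-1}}=x_{r_l}$.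 For a random vector $\mathbf X=(X_1,\dots,X_N)$ on $(\Omega,\mathbb B(\Omega))$ with real components, the ordinal partition $\mathcal P^{\mathbf X}(d)$ of order $d$ has as its elements, for all $N$-tuples $(\pi_1,\dots,\pi_N)$ of permutations of $\{0,\dots,d\}$, the sets of all $\omega\in\Omega$ such that for $i=1,\dots,N$ the vector $(X_i(T^{d}\omega),X_i(T^{d-1}\omega),\dots,X_i(T\omega),X_i(\omega))$ has the ordinal pattern $\pi_i$. The conditional entropy of ordinal patterns of order $d$ is $$h^{\mathbf X}_{\mu,\mathrm{cond}}(T,d)=H(\mathcal P^{\mathbf X}(d)_2)-H(\mathcal P^{\mathbf X}(d)).$$ A finite partition $\mathcal G=\{G_0,\dots,G_l\}$ is generating (under $T$) if for every $B\in\mathbb B(\Omega)$ there is a set $A$ in the $\sigma$-algebra generated by the sets $T^{-n}(G_i)$, $n\ge 0$, $0\le i\le l$, with $\mu(A\bigtriangleup B)=0$. A finite partition $\mathcal M=\{M_0,\dots,M_l\}$ has the Markov property (with respect to $T$ and $\mu$) if for all $n\ge1$ and all $i_0,\dots,i_n\in\{0,\dots,l\}$ with $\mu\bigl(\bigcap_{j=0}^{n-1}T^{-j}(M_{i_j})\bigr)>0$,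 $$\frac{\mu\bigl(\bigcap_{j=0}^{n}T^{-j}(M_{i_j})\bigr)}{\mu\bigl(\bigcap_{j=0}^{n-1}T^{-j}(M_{i_j})\bigr)}=\frac{\mu\bigl(M_{i_{n-1}}\cap T^{-1}(M_{i_n})\bigr)}{\mu(M_{i_{n-1}})}.$$ **Lemma.** Assume that $\mathbf X$ provides the ordinal representation of the KS entropy, that is, $$h_\mu(T)=\lim_{d\to\infty}h_\mu(T,\mathcal P^{\mathbf X}(d))=\lim_{d\to\infty}\lim_{n\to\infty}\bigl(H(\mathcal P^{\mathbf X}(d)_{n+1})-H(\mathcal P^{\mathbf X}(d)_n)\bigr).$$ Then the following two statements hold. (i) If, for some $d_0$, $\mathcal P^{\mathbf X}(d)$ has the Markov property for all $d\ge d_0$, then $h_\mu(T)=\lim_{d\to\infty}h^{\mathbf X}_{\mu,\mathrm{cond}}(T,d)$. (ii) If $\mathcal P^{\mathbf X}(d)$ is generating and has the Markov property for some $d$, then $h_\mu(T)=h^{\mathbf X}_{\mu,\mathrm{cond}}(T,d)$ for this $d$. -/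

import Mathlib

open MeasureTheory Filter Topology

noncomputable section

namespace OrdinalEntropy

variable {Ω : Type*}

/-- A finite measurable partition of `Ω`, given as a family of cells indexed by a finite type.
Empty cells are allowed; they have measure zero and do not affect any entropy. -/
structure IsFinitePartition [MeasurableSpace Ω] {ι : Type*} [Fintype ι] (P : ι → Set Ω) : Prop where
  measurableSet : ∀ i, MeasurableSet (P i)
  disjoint : Pairwise fun i j => Disjoint (P i) (P j)
  iUnion_eq : ⋃ i, P i = Set.univ

/-- The refined partition `P_n`: the word `a = a₀ a₁ … a_{n-1}` is sent to
`P a₀ ∩ T⁻¹ (P a₁) ∩ … ∩ T^{-(n-1)} (P a_{n-1})`. -/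
def refinement (T : Ω → Ω) {ι : Type*} (P : ι → Set Ω) (n : ℕ) : (Fin n → ι) → Set Ω :=
  fun a => ⋂ j : Fin n, T^[(j : ℕ)] ⁻¹' P (a j)

/-- Shannon entropy `H(P) = - ∑ μ(P_i) ln μ(P_i)`, with `0 ln 0 = 0`. -/
def shannonEntropy [MeasurableSpace Ω] (μ : Measure Ω) {ι : Type*} [Fintype ι]
    (P : ι → Set Ω) : ℝ :=
  - ∑ i, μ.real (P i) * Real.log (μ.real (P i))

/-- Entropy rate `h_μ(T, P) = lim_n (H(P_{n+1}) - H(P_n))`.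
The limit exists whenever `T` preserves the probability measure `μ` and `P` is a
finite measurable partition. -/
def entropyRate [MeasurableSpace Ω] (μ : Measure Ω) (T : Ω → Ω) {ι : Type*} [Fintype ι]
    (P : ι → Set Ω) : ℝ :=
  limUnder atTop fun n : ℕ =>
    shannonEntropy μ (refinement T P (n + 1)) - shannonEntropy μ (refinement T P n)

/-- Kolmogorov-Sinai entropy: the supremum, possibly `+∞`, of the entropy rates of all finite
measurable partitions. -/
def ksEntropy [MeasurableSpace Ω] (μ : Measure Ω) (T : Ω → Ω) : EReal :=
  ⨆ (k : ℕ) (P : Fin k → Set Ω) (_ : IsFinitePartition P), ((entropyRate μ T P : ℝ) : EReal)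

/-- The vector `(x_0, …, x_d)` has the ordinal pattern `π = (r_0, …, r_d)`:
`x_{r_0} ≥ x_{r_1} ≥ … ≥ x_{r_d}`, and `r_{l-1} > r_l` whenever `x_{r_{l-1}} = x_{r_l}`. -/
def HasOrdinalPattern {d : ℕ} (x : Fin (d + 1) → ℝ) (π : Equiv.Perm (Fin (d + 1))) : Prop :=
  ∀ l : Fin d, x (π l.castSucc) ≥ x (π l.succ) ∧
    (x (π l.castSucc) = x (π l.succ) → π l.castSucc > π l.succ)

/-- The ordinal partition `P^X(d)`: its cells are indexed by `N`-tuples of permutations, and `ω`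
lies in the cell of `(π_1, …, π_N)` iff for each `i` the vector
`(X_i(T^d ω), X_i(T^{d-1} ω), …, X_i(T ω), X_i(ω))` has the ordinal pattern `π_i`. -/
def ordinalPartition (T : Ω → Ω) {N : ℕ} (X : Ω → Fin N → ℝ) (d : ℕ) :
    (Fin N → Equiv.Perm (Fin (d + 1))) → Set Ω :=
  fun π => {ω | ∀ i, HasOrdinalPattern (fun k : Fin (d + 1) => X (T^[d - (k : ℕ)] ω) i) (π i)}

/-- Conditional entropy of ordinal patterns of order `d`: `H(P^X(d)_2) - H(P^X(d))`. -/
def condEntropy [MeasurableSpace Ω] (μ : Measure Ω) (T : Ω → Ω) {N : ℕ} (X : Ω → Fin N → ℝ)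
    (d : ℕ) : ℝ :=
  shannonEntropy μ (refinement T (ordinalPartition T X d) 2) -
    shannonEntropy μ (ordinalPartition T X d)

/-- The ordinal representation of the KS entropy:
`h_μ(T) = lim_d h_μ(T, P^X(d)) = lim_d lim_n (H(P^X(d)_{n+1}) - H(P^X(d)_n))`. -/
def OrdinalRepresentation [MeasurableSpace Ω] (μ : Measure Ω) (T : Ω → Ω) {N : ℕ}
    (X : Ω → Fin N → ℝ) : Prop :=
  Tendsto (fun d : ℕ => ((entropyRate μ T (ordinalPartition T X d) : ℝ) : EReal)) atTop
    (𝓝 (ksEntropy μ T))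

/-- The partition `G` is generating under `T`: every measurable set agrees, up to a `μ`-null set,
with a member of the sigma-algebra generated by the sets `T^{-n}(G_i)`, `n ≥ 0`. -/
def IsGenerating [MeasurableSpace Ω] (μ : Measure Ω) (T : Ω → Ω) {ι : Type*}
    (G : ι → Set Ω) : Prop :=
  ∀ B : Set Ω, MeasurableSet B →
    ∃ A : Set Ω,
      MeasurableSet[MeasurableSpace.generateFrom {S | ∃ (n : ℕ) (i : ι), S = T^[n] ⁻¹' G i}] A ∧
      μ (symmDiff A B) = 0

/-- The Markov property of the partition `M` with respect to `T` and `μ`.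
Words `i_0 i_1 … i_n` of the definition have `n = m + 1 ≥ 1`; `Fin.init` drops the last letter. -/
def HasMarkovProperty [MeasurableSpace Ω] (μ : Measure Ω) (T : Ω → Ω) {ι : Type*}
    (M : ι → Set Ω) : Prop :=
  ∀ (m : ℕ) (i : Fin (m + 2) → ι),
    0 < μ.real (refinement T M (m + 1) (Fin.init i)) →
      μ.real (refinement T M (m + 2) i) / μ.real (refinement T M (m + 1) (Fin.init i)) =
        μ.real (M (i (Fin.last m).castSucc) ∩ T ⁻¹' M (i (Fin.last (m + 1)))) /
          μ.real (M (i (Fin.last m).castSucc))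

end OrdinalEntropy

end

/-!
For a partition `P` the increments `H(P_{n+1}) - H(P_n)` decrease to the entropy rate `h(T, P)`,
by strong subadditivity of entropy (`mapEntropy_submodular`) and invariance of `μ`. Both
statements follow from two facts about a finite partition `P`, applied to the ordinal partitions.

* If `P` is Markov, the conditional probability of a new symbol depends on the previous symbol
  only. The information gained by it is thus a function of `ω` composed with a power of `T`, and by
  invariance all increments with `n ≥ 1` equal `H(P_2) - H(P)`, which is therefore the entropy rate
  (`HasMarkovProperty.entropyRate_eq`). This turns the ordinal representation of the
  Kolmogorov–Sinai entropy into a limit of conditional entropies.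
* If `P` is generating, its entropy rate is the Kolmogorov–Sinai entropy
  (`IsGenerating.ksEntropy_eq`). Every finite partition `Q` satisfies
  `h(T, Q) ≤ (H(P_{N+1}) - H(P_N)) + H(Q | P_N)` (`entropyRate_le_increment_add_cond`), and the last
  term tends to zero because the cells of `Q` are approximated in measure by unions of cells of
  `P_N` (`condMapEntropy_le_of_approx`).

Partitions are handled as level sets of finite-valued maps `f`, whose refinements are the level
sets of itineraries (`word`), and entropy as the integral of the information function
(`mapEntropy`), so that relabelling cells does not matter and identities between entropies become
pointwise identities between integrands. The ordinal patterns do partition `Ω` because they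
correspond to the stable sorting permutation (`hasOrdinalPattern_iff`).
-/

namespace OrdinalEntropy

variable {Ω ι κ α β γ : Type*}

/-! ### Entropy of finite-valued maps -/

section Entropy

variable [MeasurableSpace Ω] {μ : Measure Ω}

/-- The entropy of a map `f`, that is, of the partition of `Ω` into the level sets of `f`, written
as the mean of the information function `ω ↦ -ln μ(f = f ω)`. It depends on `f` only through its
level sets. -/
noncomputable def mapEntropy (μ : Measure Ω) (f : Ω → ι) : ℝ :=
  ∫ ω, -Real.log (μ.real (f ⁻¹' {f ω})) ∂μ

/-- The entropy of `f` conditioned on `g`. -/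
noncomputable def condMapEntropy (μ : Measure Ω) (f : Ω → ι) (g : Ω → κ) : ℝ :=
  mapEntropy μ (fun ω => (f ω, g ω)) - mapEntropy μ g

theorem mapEntropy_congr {f : Ω → ι} {g : Ω → κ} (h : ∀ ω ω', f ω = f ω' ↔ g ω = g ω') :
    mapEntropy μ f = mapEntropy μ g := by
  have : ∀ ω, f ⁻¹' {f ω} = g ⁻¹' {g ω} := fun ω => by ext ω'; exact h ω' ω
  simp only [mapEntropy, this]

theorem condMapEntropy_prod (f : Ω → α) (g : Ω → β) (h : Ω → γ) :
    condMapEntropy μ (fun ω => (f ω, g ω)) h =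
      condMapEntropy μ f (fun ω => (g ω, h ω)) + condMapEntropy μ g h := by
  have : mapEntropy μ (fun ω => ((f ω, g ω), h ω)) = mapEntropy μ (fun ω => (f ω, g ω, h ω)) :=
    mapEntropy_congr fun ω ω' => by simp [and_assoc]
  unfold condMapEntropy
  linarith

variable [IsProbabilityMeasure μ]

theorem integral_comp_eq_sum {ι : Type*} [Fintype ι] [MeasurableSpace ι]
    [MeasurableSingletonClass ι] {f : Ω → ι} (hf : Measurable f) (g : ι → ℝ) :
    ∫ ω, g (f ω) ∂μ = ∑ i, μ.real (f ⁻¹' {i}) * g i := by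
  have := integral_map (μ := μ) (φ := f) hf.aemeasurable (f := g) (by fun_prop)
  rw [← this, integral_fintype Integrable.of_finite]
  simp [map_measureReal_apply hf]

theorem sum_measureReal_fiber {ι : Type*} [Fintype ι] [MeasurableSpace ι]
    [MeasurableSingletonClass ι] {f : Ω → ι} (hf : Measurable f) (A : Set Ω) :
    ∑ i, μ.real (f ⁻¹' {i} ∩ A) = μ.real A := by
  have := sum_measureReal_preimage_singleton (μ := μ.restrict A) Finset.univ (f := f)
    (fun y _ => hf (measurableSet_singleton y))
  simpa [measureReal_restrict_apply (hf (measurableSet_singleton _))] using this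

theorem sum_measureReal_prod_fiber {ι : Type*} [Fintype ι] [MeasurableSpace ι]
    [MeasurableSingletonClass ι] {f : Ω → ι} (hf : Measurable f) (g : Ω → κ) (k : κ) :
    ∑ i, μ.real ((fun ω => (f ω, g ω)) ⁻¹' {(i, k)}) = μ.real (g ⁻¹' {k}) := by
  rw [← sum_measureReal_fiber (μ := μ) hf]
  refine Finset.sum_congr rfl fun i _ => congrArg _ ?_
  ext ω; simp

variable [Finite ι] [MeasurableSpace ι] [MeasurableSingletonClass ι]
variable [Finite κ] [MeasurableSpace κ] [MeasurableSingletonClass κ]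
variable [Finite α] [MeasurableSpace α] [MeasurableSingletonClass α]
variable [Finite β] [MeasurableSpace β] [MeasurableSingletonClass β]
variable [Finite γ] [MeasurableSpace γ] [MeasurableSingletonClass γ]

theorem integrable_comp_of_finite {f : Ω → ι} (hf : Measurable f) (g : ι → ℝ) :
    Integrable (fun ω => g (f ω)) μ :=
  (Integrable.of_finite (μ := μ.map f) (f := g)).comp_measurable hf

theorem integrable_information {f : Ω → ι} (hf : Measurable f) :
    Integrable (fun ω => -Real.log (μ.real (f ⁻¹' {f ω}))) μ :=
  integrable_comp_of_finite hf fun i => -Real.log (μ.real (f ⁻¹' {i}))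

theorem ae_measureReal_fiber_pos {f : Ω → ι} (hf : Measurable f) :
    ∀ᵐ ω ∂μ, 0 < μ.real (f ⁻¹' {f ω}) := by
  have h : ∀ᵐ i ∂(μ.map f), 0 < μ.real (f ⁻¹' {i}) := by
    rw [ae_iff_of_countable]
    intro i hi
    rw [Measure.map_apply hf (measurableSet_singleton i)] at hi
    exact ENNReal.toReal_pos hi (by finiteness)
  exact ae_of_ae_map hf.aemeasurable h

theorem mapEntropy_comp {T : Ω → Ω} (hT : MeasurePreserving T μ μ) {f : Ω → ι}
    (hf : Measurable f) : mapEntropy μ (fun ω => f (T ω)) = mapEntropy μ f := by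
  have h (i : ι) : μ.real ((fun ω => f (T ω)) ⁻¹' {i}) = μ.real (f ⁻¹' {i}) :=
    hT.measureReal_preimage (hf (measurableSet_singleton i)).nullMeasurableSet
  have := integral_map (μ := μ) hT.measurable.aemeasurable
    (f := fun ω => -Real.log (μ.real (f ⁻¹' {f ω}))) (by
      rw [hT.map_eq]; exact (integrable_information hf).aestronglyMeasurable)
  rw [hT.map_eq] at this
  simp only [mapEntropy, h, this]

/-- A coarser partition has smaller entropy. -/
theorem mapEntropy_mono {f : Ω → ι} {g : Ω → κ} (hf : Measurable f) (hg : Measurable g)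
    (h : ∀ ω ω', f ω = f ω' → g ω = g ω') : mapEntropy μ g ≤ mapEntropy μ f := by
  refine integral_mono_ae (integrable_information hg) (integrable_information hf) ?_
  filter_upwards [ae_measureReal_fiber_pos (μ := μ) hf] with ω hω
  refine neg_le_neg (Real.log_le_log hω (measureReal_mono fun ω' hω' => ?_))
  exact h ω' ω hω'

/-- Strong subadditivity of entropy. With `p` the joint law, it is the integral of `ln r ≤ r - 1`
for `r = p(x,z) p(y,z) / (p(x,y,z) p(z))`, whose mean is at most one. -/
theorem mapEntropy_submodular {f : Ω → α} {g : Ω → β} {h : Ω → γ}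
    (hf : Measurable f) (hg : Measurable g) (hh : Measurable h) :
    mapEntropy μ (fun ω => (f ω, g ω, h ω)) + mapEntropy μ h ≤
      mapEntropy μ (fun ω => (f ω, h ω)) + mapEntropy μ (fun ω => (g ω, h ω)) := by
  have := Fintype.ofFinite α
  have := Fintype.ofFinite β
  have := Fintype.ofFinite γ
  have hfh := hf.prodMk hh
  have hgh := hg.prodMk hh
  have hfgh := hf.prodMk hgh
  set a : α × β × γ → ℝ := fun x => μ.real ((fun ω => (f ω, g ω, h ω)) ⁻¹' {x})
  set b : α × γ → ℝ := fun x => μ.real ((fun ω => (f ω, h ω)) ⁻¹' {x})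
  set c : β × γ → ℝ := fun x => μ.real ((fun ω => (g ω, h ω)) ⁻¹' {x})
  set e : γ → ℝ := fun x => μ.real (h ⁻¹' {x})
  set r : α × β × γ → ℝ := fun x => b (x.1, x.2.2) * c x.2 / (a x * e x.2.2)
  have hr : ∫ ω, r (f ω, g ω, h ω) ∂μ ≤ 1 := by
    rw [integral_comp_eq_sum hfgh]
    calc ∑ x, a x * r x ≤ ∑ x : α × β × γ, b (x.1, x.2.2) * c x.2 / e x.2.2 := by
          refine Finset.sum_le_sum fun x _ => ?_
          -- The inequality is strict where `p(x,y,z)` vanishes but `p(x,z) p(y,z)` does not.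
          rcases eq_or_ne (a x) 0 with h0 | h0
          · simp only [h0, zero_mul]
            positivity
          · refine le_of_eq ?_
            simp only [r]
            rw [mul_div_assoc', mul_div_mul_left _ _ h0]
      _ = ∑ z : γ, (∑ x : α, b (x, z)) * (∑ y : β, c (y, z)) / e z := by
          simp only [Fintype.sum_prod_type, Finset.sum_mul_sum, Finset.sum_div]
          rw [Finset.sum_comm' (t' := Finset.univ) (s' := fun _ => Finset.univ) (by simp)]
          rw [Finset.sum_congr rfl fun y _ => Finset.sum_comm, Finset.sum_comm]
          exact Finset.sum_congr rfl fun z _ => Finset.sum_comm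
      _ = ∑ z : γ, e z := by
          refine Finset.sum_congr rfl fun z _ => ?_
          simp only [b, c, e, sum_measureReal_prod_fiber hf, sum_measureReal_prod_fiber hg]
          -- With division by zero read as zero, this also covers the values `z` of mass zero.
          rw [mul_self_div_self]
      _ = 1 := by
          simpa [e] using sum_measureReal_fiber (μ := μ) hh Set.univ
  have ia : Integrable (fun ω => -Real.log (a (f ω, g ω, h ω))) μ := integrable_information hfgh
  have ib : Integrable (fun ω => -Real.log (b (f ω, h ω))) μ := integrable_information hfh
  have ic : Integrable (fun ω => -Real.log (c (g ω, h ω))) μ := integrable_information hgh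
  have ie : Integrable (fun ω => -Real.log (e (h ω))) μ := integrable_information hh
  have ibc : Integrable (fun ω => -Real.log (b (f ω, h ω)) + -Real.log (c (g ω, h ω))) μ := ib.add ic
  have ir : Integrable (fun ω => r (f ω, g ω, h ω)) μ := integrable_comp_of_finite hfgh r
  have ir1 : Integrable (fun ω => r (f ω, g ω, h ω) - 1) μ := ir.sub (integrable_const 1)
  have key : ∫ ω, (-Real.log (a (f ω, g ω, h ω)) + -Real.log (e (h ω))) ∂μ ≤
      ∫ ω, (-Real.log (b (f ω, h ω)) + -Real.log (c (g ω, h ω)) + (r (f ω, g ω, h ω) - 1)) ∂μ := by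
    refine integral_mono_ae (ia.add ie) (ibc.add ir1) ?_
    filter_upwards [ae_measureReal_fiber_pos (μ := μ) hfgh, ae_measureReal_fiber_pos (μ := μ) hfh,
      ae_measureReal_fiber_pos (μ := μ) hgh, ae_measureReal_fiber_pos (μ := μ) hh] with ω h1 h2 h3 h4
    change 0 < a (f ω, g ω, h ω) at h1
    change 0 < b (f ω, h ω) at h2
    change 0 < c (g ω, h ω) at h3
    change 0 < e (h ω) at h4
    have := Real.log_le_sub_one_of_pos (show 0 < r (f ω, g ω, h ω) by simp only [r]; positivity)
    simp only [r] at this ⊢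
    rw [Real.log_div (by positivity) (by positivity), Real.log_mul h2.ne' h3.ne',
      Real.log_mul h1.ne' h4.ne'] at this
    linarith
  rw [integral_add ia ie, integral_add ibc ir1, integral_add ib ic,
    integral_sub ir (integrable_const 1)] at key
  simp only [integral_const, probReal_univ, smul_eq_mul, mul_one] at key
  change (∫ ω, -Real.log (a (f ω, g ω, h ω)) ∂μ) + (∫ ω, -Real.log (e (h ω)) ∂μ) ≤
    (∫ ω, -Real.log (b (f ω, h ω)) ∂μ) + (∫ ω, -Real.log (c (g ω, h ω)) ∂μ)
  linarith

theorem condMapEntropy_nonneg {f : Ω → α} {g : Ω → β} (hf : Measurable f) (hg : Measurable g) :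
    0 ≤ condMapEntropy μ f g :=
  sub_nonneg.2 (mapEntropy_mono (hf.prodMk hg) hg fun _ _ h => (Prod.ext_iff.1 h).2)

/-- Conditioning on a finer partition decreases entropy. -/
theorem condMapEntropy_anti {f : Ω → α} {g : Ω → β} {h : Ω → γ} (hf : Measurable f)
    (hg : Measurable g) (hh : Measurable h) (hgh : ∀ ω ω', g ω = g ω' → h ω = h ω') :
    condMapEntropy μ f g ≤ condMapEntropy μ f h := by
  have key := mapEntropy_submodular (μ := μ) hf hg hh
  have h1 : mapEntropy μ (fun ω => (f ω, g ω, h ω)) = mapEntropy μ (fun ω => (f ω, g ω)) :=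
    mapEntropy_congr fun ω ω' => by simp; grind
  have h2 : mapEntropy μ (fun ω => (g ω, h ω)) = mapEntropy μ g :=
    mapEntropy_congr fun ω ω' => by simp; grind
  unfold condMapEntropy
  linarith

theorem condMapEntropy_comp {T : Ω → Ω} (hT : MeasurePreserving T μ μ) {f : Ω → α} {g : Ω → β}
    (hf : Measurable f) (hg : Measurable g) :
    condMapEntropy μ (fun ω => f (T ω)) (fun ω => g (T ω)) = condMapEntropy μ f g := by
  unfold condMapEntropy
  rw [mapEntropy_comp hT hg, ← mapEntropy_comp hT (hf.prodMk hg)]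

/-- If every level set of `f` is, up to measure `ε`, a union of level sets of `g`, then the entropy
of `f` given `g` is small. -/
theorem condMapEntropy_le_of_approx {ι : Type*} [Fintype ι] [MeasurableSpace ι]
    [MeasurableSingletonClass ι] {f : Ω → ι} {g : Ω → κ} (hf : Measurable f) (hg : Measurable g)
    {δ ε : ℝ} (hδ : 0 < δ) (hδ1 : δ ≤ 1)
    (h : ∀ i, ∃ S : Set κ, μ.real (symmDiff (f ⁻¹' {i}) (g ⁻¹' S)) ≤ ε) :
    condMapEntropy μ f g ≤ Fintype.card ι * (δ + (1 - Real.log δ) * ε) := by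
  classical
  have := Fintype.ofFinite κ
  have hfg := hf.prodMk hg
  set s : ι × κ → ℝ := fun x => μ.real ((fun ω => (f ω, g ω)) ⁻¹' {x})
  set c : κ → ℝ := fun k => μ.real (g ⁻¹' {k})
  have hlog : Real.log δ ≤ 0 := Real.log_nonpos hδ.le hδ1
  have hs0 (x) : 0 ≤ s x := measureReal_nonneg
  have hsc (i k) : s (i, k) ≤ c k :=
    measureReal_mono fun ω hω => by
      have : (f ω, g ω) = (i, k) := hω
      exact (Prod.ext_iff.1 this).2
  have heq : condMapEntropy μ f g = ∑ i, ∑ k, s (i, k) * (Real.log (c k) - Real.log (s (i, k))) := by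
    rw [← Fintype.sum_prod_type' fun i k => s (i, k) * (Real.log (c k) - Real.log (s (i, k)))]
    rw [← integral_comp_eq_sum hfg (fun x => Real.log (c x.2) - Real.log (s x))]
    unfold condMapEntropy mapEntropy
    rw [← integral_sub (integrable_information hfg) (integrable_information hg)]
    exact integral_congr_ae (.of_forall fun ω => by simp only [s, c]; ring)
  rw [heq, ← nsmul_eq_mul]
  refine Finset.sum_le_card_nsmul _ _ _ fun i _ => ?_
  obtain ⟨S, hS⟩ := h i
  -- On a level set of `g` contained in the approximating union, `s ln (c/s)` is bounded by
  -- `c - s`; on the others, by `δ c + s ln (1/δ)`.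
  have hin (k) : s (i, k) * (Real.log (c k) - Real.log (s (i, k))) ≤ c k - s (i, k) := by
    rcases (hs0 (i, k)).eq_or_lt with h0 | h0
    · rw [← h0]; simp [c]
    · have hc := h0.trans_le (hsc i k)
      have := Real.log_le_sub_one_of_pos (div_pos hc h0)
      rw [Real.log_div hc.ne' h0.ne'] at this
      calc _ ≤ s (i, k) * (c k / s (i, k) - 1) := by gcongr
        _ = _ := by field_simp
  have hout (k) : s (i, k) * (Real.log (c k) - Real.log (s (i, k))) ≤
      δ * c k + -Real.log δ * s (i, k) := by
    rcases (hs0 (i, k)).eq_or_lt with h0 | h0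
    · rw [← h0]; simp only [zero_mul, mul_zero, add_zero]
      exact mul_nonneg hδ.le measureReal_nonneg
    · have hc := h0.trans_le (hsc i k)
      have := Real.log_le_sub_one_of_pos (div_pos (mul_pos hδ hc) h0)
      rw [Real.log_div (mul_pos hδ hc).ne' h0.ne', Real.log_mul hδ.ne' hc.ne'] at this
      calc _ ≤ s (i, k) * (δ * c k / s (i, k) - 1 - Real.log δ) :=
            mul_le_mul_of_nonneg_left (by linarith) h0.le
        _ = δ * c k - s (i, k) + -Real.log δ * s (i, k) := by field_simp; ring
        _ ≤ _ := by linarith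
  have hbound (k) : s (i, k) * (Real.log (c k) - Real.log (s (i, k))) ≤
      δ * c k + (1 - Real.log δ) *
        μ.real (g ⁻¹' {k} ∩ symmDiff (f ⁻¹' {i}) (g ⁻¹' S)) := by
    have hc0 : 0 ≤ δ * c k := mul_nonneg hδ.le measureReal_nonneg
    by_cases hk : k ∈ S
    · have : c k - s (i, k) = μ.real (g ⁻¹' {k} ∩ symmDiff (f ⁻¹' {i}) (g ⁻¹' S)) := by
        simp only [s, c]
        rw [← measureReal_sdiff]
        · congr 1; ext ω; simp [Set.mem_symmDiff]; grind
        · intro ω hω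
          have : (f ω, g ω) = (i, k) := hω
          exact (Prod.ext_iff.1 this).2
        · exact hfg (measurableSet_singleton _)
      rw [← this]
      nlinarith [hin k, hsc i k]
    · have : s (i, k) = μ.real (g ⁻¹' {k} ∩ symmDiff (f ⁻¹' {i}) (g ⁻¹' S)) := by
        simp only [s]
        congr 1; ext ω; simp [Set.mem_symmDiff]; grind
      rw [← this]
      linarith [hout k, hs0 (i, k)]
  calc _ ≤ _ := Finset.sum_le_sum fun k _ => hbound k
    _ = δ + (1 - Real.log δ) * μ.real (symmDiff (f ⁻¹' {i}) (g ⁻¹' S)) := by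
        rw [Finset.sum_add_distrib, ← Finset.mul_sum, ← Finset.mul_sum, sum_measureReal_fiber hg]
        have : ∑ k, c k = 1 := by simpa [c] using sum_measureReal_fiber (μ := μ) hg Set.univ
        rw [this, mul_one]
    _ ≤ _ := by
        have : 0 ≤ 1 - Real.log δ := by linarith
        gcongr

end Entropy

/-! ### Words along orbits and entropy rates -/

/-- The length-`n` itinerary `f ω, f (T ω), …, f (T^{n-1} ω)`. Its level sets are the cells of the
`n`-th refinement of the partition into level sets of `f`. -/
def word (T : Ω → Ω) (f : Ω → ι) (n : ℕ) (ω : Ω) : Fin n → ι := fun j => f (T^[j] ω)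

theorem word_eq_iff {T : Ω → Ω} {f : Ω → ι} {n : ℕ} {ω ω' : Ω} :
    word T f n ω = word T f n ω' ↔ ∀ j < n, f (T^[j] ω) = f (T^[j] ω') := by
  simp [word, funext_iff, Fin.forall_iff]

theorem word_eq_of_le {T : Ω → Ω} {f : Ω → ι} {m n : ℕ} (hmn : m ≤ n) {ω ω' : Ω}
    (h : word T f n ω = word T f n ω') : word T f m ω = word T f m ω' :=
  word_eq_iff.2 fun j hj => word_eq_iff.1 h j (hj.trans_le hmn)

theorem word_iterate_eq {T : Ω → Ω} {f : Ω → ι} {k m n : ℕ} (hmn : k + m ≤ n) {ω ω' : Ω}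
    (h : word T f n ω = word T f n ω') :
    word T f m (T^[k] ω) = word T f m (T^[k] ω') := by
  refine word_eq_iff.2 fun j hj => ?_
  simpa [Function.iterate_add_apply] using word_eq_iff.1 h (j + k) (by omega)

theorem word_succ_eq_iff {T : Ω → Ω} {f : Ω → ι} {n : ℕ} {ω ω' : Ω} :
    word T f (n + 1) ω = word T f (n + 1) ω' ↔
      f ω = f ω' ∧ word T f n (T ω) = word T f n (T ω') := by
  simp [word, funext_iff, Fin.forall_fin_succ]

theorem word_succ_eq_iff' {T : Ω → Ω} {f : Ω → ι} {n : ℕ} {ω ω' : Ω} :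
    word T f (n + 1) ω = word T f (n + 1) ω' ↔
      f (T^[n] ω) = f (T^[n] ω') ∧ word T f n ω = word T f n ω' := by
  simp only [word, funext_iff, Fin.forall_fin_succ', Fin.val_castSucc, Fin.val_last]
  exact and_comm

theorem refinement_fiber (T : Ω → Ω) (f : Ω → ι) (n : ℕ) :
    refinement T (fun i => f ⁻¹' {i}) n = fun a => word T f n ⁻¹' {a} := by
  ext a ω
  simp [refinement, word, funext_iff]

section Dynamics

variable [MeasurableSpace Ω] {μ : Measure Ω} {T : Ω → Ω}

theorem measurable_word [MeasurableSpace ι] (hT : Measurable T) {f : Ω → ι} (hf : Measurable f)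
    (n : ℕ) : Measurable (word T f n) :=
  measurable_pi_lambda _ fun j => hf.comp (hT.iterate j)

variable [IsProbabilityMeasure μ]

theorem shannonEntropy_fiber [Fintype ι] [MeasurableSpace ι] [MeasurableSingletonClass ι]
    {f : Ω → ι} (hf : Measurable f) :
    shannonEntropy μ (fun i => f ⁻¹' {i}) = mapEntropy μ f := by
  unfold mapEntropy shannonEntropy
  rw [integral_comp_eq_sum hf (fun i => -Real.log (μ.real (f ⁻¹' {i})))]
  simp

/-- The increment `H(P_{n+1}) - H(P_n)` for the partition `P` into level sets of `f`. -/
noncomputable def entropyIncrement (μ : Measure Ω) (T : Ω → Ω) (f : Ω → ι) (n : ℕ) : ℝ :=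
  mapEntropy μ (word T f (n + 1)) - mapEntropy μ (word T f n)

theorem entropyRate_fiber [Fintype ι] [MeasurableSpace ι] [MeasurableSingletonClass ι]
    (hT : Measurable T) {f : Ω → ι} (hf : Measurable f) :
    entropyRate μ T (fun i => f ⁻¹' {i}) = limUnder atTop (entropyIncrement μ T f) := by
  simp only [entropyRate, refinement_fiber, shannonEntropy_fiber (measurable_word hT hf _)]
  rfl

theorem mapEntropy_word_zero (f : Ω → ι) : mapEntropy μ (word T f 0) = 0 := by
  have (ω : Ω) : word T f 0 ⁻¹' {word T f 0 ω} = Set.univ := by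
    ext; simp [eq_iff_true_of_subsingleton]
  simp [mapEntropy, this]

variable [Finite ι] [MeasurableSpace ι] [MeasurableSingletonClass ι]
variable [Finite κ] [MeasurableSpace κ] [MeasurableSingletonClass κ]

theorem entropyIncrement_eq_cond (hT : MeasurePreserving T μ μ) {f : Ω → ι} (hf : Measurable f)
    (n : ℕ) : entropyIncrement μ T f n = condMapEntropy μ f (fun ω => word T f n (T ω)) := by
  have h : mapEntropy μ (word T f (n + 1)) = mapEntropy μ (fun ω => (f ω, word T f n (T ω))) :=
    mapEntropy_congr fun ω ω' => by simp [word_succ_eq_iff]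
  rw [entropyIncrement, condMapEntropy, h, mapEntropy_comp hT (measurable_word hT.measurable hf n)]

theorem entropyIncrement_nonneg (hT : MeasurePreserving T μ μ) {f : Ω → ι} (hf : Measurable f)
    (n : ℕ) : 0 ≤ entropyIncrement μ T f n := by
  rw [entropyIncrement_eq_cond hT hf]
  exact condMapEntropy_nonneg hf ((measurable_word hT.measurable hf n).comp hT.measurable)

theorem entropyIncrement_antitone (hT : MeasurePreserving T μ μ) {f : Ω → ι} (hf : Measurable f) :
    Antitone (entropyIncrement μ T f) := by
  intro m n hmn
  rw [entropyIncrement_eq_cond hT hf, entropyIncrement_eq_cond hT hf]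
  exact condMapEntropy_anti hf ((measurable_word hT.measurable hf n).comp hT.measurable)
    ((measurable_word hT.measurable hf m).comp hT.measurable) fun ω ω' h => word_eq_of_le hmn h

theorem tendsto_entropyIncrement {ι : Type*} [Fintype ι] [MeasurableSpace ι]
    [MeasurableSingletonClass ι] (hT : MeasurePreserving T μ μ) {f : Ω → ι} (hf : Measurable f) :
    Tendsto (entropyIncrement μ T f) atTop (𝓝 (entropyRate μ T fun i => f ⁻¹' {i})) := by
  rw [entropyRate_fiber hT.measurable hf]
  refine tendsto_nhds_limUnder ⟨_, tendsto_atTop_ciInf (entropyIncrement_antitone hT hf) ⟨0, ?_⟩⟩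
  rintro _ ⟨n, rfl⟩
  exact entropyIncrement_nonneg hT hf n

theorem mul_entropyRate_le_mapEntropy_word {ι : Type*} [Fintype ι] [MeasurableSpace ι]
    [MeasurableSingletonClass ι] (hT : MeasurePreserving T μ μ) {f : Ω → ι} (hf : Measurable f)
    (n : ℕ) : n * entropyRate μ T (fun i => f ⁻¹' {i}) ≤ mapEntropy μ (word T f n) := by
  induction n with
  | zero => simp [mapEntropy_word_zero]
  | succ n ih =>
    have := (entropyIncrement_antitone hT hf).le_of_tendsto (tendsto_entropyIncrement hT hf) n
    unfold entropyIncrement at this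
    push_cast
    linarith

theorem mapEntropy_word_add_le (hT : MeasurePreserving T μ μ) {f : Ω → ι} (hf : Measurable f)
    (n N : ℕ) : mapEntropy μ (word T f (n + N)) ≤
      mapEntropy μ (word T f N) + n * entropyIncrement μ T f N := by
  induction n with
  | zero => rw [Nat.zero_add]; simp
  | succ n ih =>
    have := entropyIncrement_antitone hT hf (Nat.le_add_left N n)
    rw [entropyIncrement] at this
    rw [Nat.add_right_comm]
    push_cast
    linarith

theorem condMapEntropy_word_le (hT : MeasurePreserving T μ μ) {f : Ω → ι} {g : Ω → κ}
    (hf : Measurable f) (hg : Measurable g) (n N : ℕ) :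
    condMapEntropy μ (word T f n) (word T g (n + N)) ≤
      n * condMapEntropy μ f (word T g N) := by
  have hw := fun k => measurable_word hT.measurable hf k
  have hv := fun k => measurable_word hT.measurable hg k
  induction n with
  | zero =>
    have : mapEntropy μ (fun ω => (word T f 0 ω, word T g (0 + N) ω)) =
        mapEntropy μ (word T g (0 + N)) :=
      mapEntropy_congr fun ω ω' => by simp [eq_iff_true_of_subsingleton]
    simp [condMapEntropy, this]
  | succ n ih =>
    have hTn := hT.iterate n
    have hfn := hf.comp hTn.measurable
    have h1 : condMapEntropy μ (word T f (n + 1)) (word T g (n + 1 + N)) =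
        condMapEntropy μ (fun ω => (f (T^[n] ω), word T f n ω)) (word T g (n + 1 + N)) := by
      unfold condMapEntropy
      congr 1
      exact mapEntropy_congr fun ω ω' => by simp [word_succ_eq_iff']
    have h2 : condMapEntropy μ (fun ω => f (T^[n] ω))
        (fun ω => (word T f n ω, word T g (n + 1 + N) ω)) ≤ condMapEntropy μ f (word T g N) := by
      rw [← condMapEntropy_comp hTn hf (hv N)]
      refine condMapEntropy_anti hfn ((hw n).prodMk (hv _)) ((hv N).comp hTn.measurable) ?_
      intro ω ω' h
      exact word_iterate_eq (by omega) (Prod.ext_iff.1 h).2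
    have h3 : condMapEntropy μ (word T f n) (word T g (n + 1 + N)) ≤
        condMapEntropy μ (word T f n) (word T g (n + N)) :=
      condMapEntropy_anti (hw n) (hv _) (hv _) fun ω ω' h => word_eq_of_le (by omega) h
    rw [h1, condMapEntropy_prod]
    push_cast
    linarith

/-- The entropy rate of `f` exceeds that of `g` by at most the entropy of `f` given a long
word of `g`. -/
theorem entropyRate_le_increment_add_cond {ι : Type*} [Fintype ι] [MeasurableSpace ι]
    [MeasurableSingletonClass ι] (hT : MeasurePreserving T μ μ) {f : Ω → ι} {g : Ω → κ}
    (hf : Measurable f) (hg : Measurable g) (N : ℕ) :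
    entropyRate μ T (fun i => f ⁻¹' {i}) ≤
      entropyIncrement μ T g N + condMapEntropy μ f (word T g N) := by
  -- Both sides of the claim, multiplied by `n`, compare up to the constant `H(P_N)`.
  have key (n : ℕ) : n * (entropyRate μ T (fun i => f ⁻¹' {i}) -
      (entropyIncrement μ T g N + condMapEntropy μ f (word T g N))) ≤
      mapEntropy μ (word T g N) := by
    have h1 := mul_entropyRate_le_mapEntropy_word hT hf n
    have hw := measurable_word hT.measurable hf n
    have hv := measurable_word hT.measurable hg (n + N)
    have h2 : mapEntropy μ (word T f n) ≤
        mapEntropy μ (fun ω => (word T f n ω, word T g (n + N) ω)) :=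
      mapEntropy_mono (hw.prodMk hv) hw fun _ _ h => (Prod.ext_iff.1 h).1
    have h3 := condMapEntropy_word_le hT hf hg n N
    have h4 := mapEntropy_word_add_le hT hg n N
    unfold condMapEntropy at h3 ⊢
    linarith
  by_contra! hlt
  obtain ⟨n, hn⟩ := exists_nat_gt (mapEntropy μ (word T g N) /
    (entropyRate μ T (fun i => f ⁻¹' {i}) -
      (entropyIncrement μ T g N + condMapEntropy μ f (word T g N))))
  rw [div_lt_iff₀ (sub_pos.2 hlt)] at hn
  exact (key n).not_gt hn

end Dynamics

/-! ### Generating partitions -/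

section Generating

theorem exists_preimage_word_eq_of_le (T : Ω → Ω) (f : Ω → ι) {m n : ℕ} (hmn : m ≤ n)
    (S : Set (Fin m → ι)) :
    ∃ S' : Set (Fin n → ι), word T f n ⁻¹' S' = word T f m ⁻¹' S :=
  ⟨(fun a j => a (Fin.castLE hmn j)) ⁻¹' S, rfl⟩

/-- The sets determined by finitely many symbols of the itinerary of `f`. -/
def cylinderAlgebra (T : Ω → Ω) (f : Ω → ι) : Set (Set Ω) :=
  {A | ∃ (n : ℕ) (S : Set (Fin n → ι)), A = word T f n ⁻¹' S}

theorem isSetAlgebra_cylinderAlgebra (T : Ω → Ω) (f : Ω → ι) :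
    IsSetAlgebra (cylinderAlgebra T f) where
  empty_mem := ⟨0, ∅, rfl⟩
  compl_mem := by
    rintro _ ⟨n, S, rfl⟩
    exact ⟨n, Sᶜ, rfl⟩
  union_mem := by
    rintro _ _ ⟨m, S, rfl⟩ ⟨n, S', rfl⟩
    obtain ⟨R, hR⟩ := exists_preimage_word_eq_of_le T f (le_max_left m n) S
    obtain ⟨R', hR'⟩ := exists_preimage_word_eq_of_le T f (le_max_right m n) S'
    exact ⟨max m n, R ∪ R', by rw [Set.preimage_union, hR, hR']⟩

variable [MeasurableSpace Ω] {μ : Measure Ω} {T : Ω → Ω} [IsProbabilityMeasure μ]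

variable [Finite ι] [MeasurableSpace ι] [MeasurableSingletonClass ι]

/-- A generating partition approximates every measurable set by unions of cells of its
refinements. -/
theorem IsGenerating.eventually_exists_approx {f : Ω → ι} (hT : Measurable T) (hf : Measurable f)
    (hgen : IsGenerating μ T fun i => f ⁻¹' {i}) {B : Set Ω} (hB : MeasurableSet B)
    {ε : ℝ} (hε : 0 < ε) :
    ∀ᶠ n in atTop, ∃ S : Set (Fin n → ι), μ.real (symmDiff B (word T f n ⁻¹' S)) ≤ ε := by
  obtain ⟨A, hA, hAB⟩ := hgen B hB
  have hle : MeasurableSpace.generateFrom (cylinderAlgebra T f) ≤ ‹MeasurableSpace Ω› := by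
    refine MeasurableSpace.generateFrom_le ?_
    rintro _ ⟨n, S, rfl⟩
    exact measurable_word hT hf n S.toFinite.measurableSet
  have hA' : MeasurableSet[MeasurableSpace.generateFrom (cylinderAlgebra T f)] A := by
    refine MeasurableSpace.generateFrom_mono ?_ _ hA
    rintro _ ⟨n, i, rfl⟩
    exact ⟨n + 1, {a | a (Fin.last n) = i}, rfl⟩
  -- Density holds for the σ-algebra generated by the cylinders, to which `μ` is restricted here;
  -- the partition being generating then passes from `A` to `B`.
  have hdense := @Measure.MeasureDense.of_generateFrom_isSetAlgebra_finite Ω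
    (MeasurableSpace.generateFrom (cylinderAlgebra T f)) (μ.trim hle) _ (isFiniteMeasure_trim hle)
    (isSetAlgebra_cylinderAlgebra T f) rfl
  obtain ⟨_, ⟨n, S, rfl⟩, hS⟩ := @Measure.MeasureDense.approx Ω
    (MeasurableSpace.generateFrom (cylinderAlgebra T f)) _ _ hdense A hA'
    (by rw [trim_measurableSet_eq hle hA']; exact measure_ne_top _ _) ε hε
  rw [trim_measurableSet_eq hle (hA'.symmDiff
    (MeasurableSpace.measurableSet_generateFrom ⟨n, S, rfl⟩))] at hS
  have hBS : μ.real (symmDiff B (word T f n ⁻¹' S)) ≤ ε := by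
    refine ENNReal.toReal_le_of_le_ofReal hε.le (le_trans ?_ hS.le)
    calc _ ≤ μ (symmDiff B A) + μ (symmDiff A (word T f n ⁻¹' S)) := measure_symmDiff_le _ _ _
      _ = _ := by rw [symmDiff_comm, hAB, zero_add]
  filter_upwards [eventually_ge_atTop n] with N hN
  obtain ⟨S', hS'⟩ := exists_preimage_word_eq_of_le T f hN S
  exact ⟨S', by rwa [hS']⟩

theorem IsGenerating.tendsto_condMapEntropy {κ : Type*} [Fintype κ] [MeasurableSpace κ]
    [MeasurableSingletonClass κ] {f : Ω → ι} {g : Ω → κ} (hT : Measurable T) (hf : Measurable f)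
    (hg : Measurable g) (hgen : IsGenerating μ T fun i => f ⁻¹' {i}) :
    Tendsto (fun n => condMapEntropy μ g (word T f n)) atTop (𝓝 0) := by
  have hw := fun n => measurable_word hT hf n
  refine tendsto_order.2 ⟨fun a ha => .of_forall fun n =>
    ha.trans_le (condMapEntropy_nonneg hg (hw n)), fun a ha => ?_⟩
  have hc : (0 : ℝ) < 2 * Fintype.card κ + 1 := by positivity
  set δ : ℝ := min 1 (a / (2 * Fintype.card κ + 1))
  have hδ : 0 < δ := lt_min one_pos (div_pos ha hc)
  have hδ1 : δ ≤ 1 := min_le_left _ _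
  have hlog : 0 < 1 - Real.log δ := by linarith [Real.log_nonpos hδ.le hδ1]
  have := eventually_all.2 fun i => hgen.eventually_exists_approx hT hf
    (hg (measurableSet_singleton i)) (div_pos hδ hlog)
  filter_upwards [this] with n hn
  calc condMapEntropy μ g (word T f n)
      ≤ Fintype.card κ * (δ + (1 - Real.log δ) * (δ / (1 - Real.log δ))) :=
        condMapEntropy_le_of_approx hg (hw n) hδ hδ1 hn
    _ = 2 * Fintype.card κ * δ := by rw [mul_div_cancel₀ _ hlog.ne']; ring
    _ < (2 * Fintype.card κ + 1) * δ := by linarith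
    _ ≤ (2 * Fintype.card κ + 1) * (a / (2 * Fintype.card κ + 1)) := by
        gcongr; exact min_le_right _ _
    _ = a := mul_div_cancel₀ _ hc.ne'

end Generating

/-! ### Partitions as level sets -/

section Partition

variable [MeasurableSpace Ω] {μ : Measure Ω} {T : Ω → Ω}

theorem IsFinitePartition.exists_measurable [Fintype ι] [MeasurableSpace ι]
    [DiscreteMeasurableSpace ι] {P : ι → Set Ω} (hP : IsFinitePartition P) :
    ∃ f : Ω → ι, Measurable f ∧ P = fun i => f ⁻¹' {i} := by
  have hex (ω : Ω) : ∃ i, ω ∈ P i := Set.mem_iUnion.1 (hP.iUnion_eq ▸ Set.mem_univ ω)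
  choose f hf using hex
  have hPf : P = fun i => f ⁻¹' {i} := by
    ext i ω
    refine ⟨fun h => ?_, fun h => ?_⟩
    · by_contra hne
      exact Set.disjoint_left.1 (hP.disjoint hne) (hf ω) h
    · have : f ω = i := h
      exact this ▸ hf ω
  refine ⟨f, measurable_to_countable' fun i => ?_, hPf⟩
  have := hP.measurableSet i
  rwa [hPf] at this

variable [IsProbabilityMeasure μ] [Fintype ι]

/-- The Kolmogorov–Sinai theorem. -/
theorem IsGenerating.ksEntropy_eq (hT : MeasurePreserving T μ μ) {P : ι → Set Ω}
    (hP : IsFinitePartition P) (hgen : IsGenerating μ T P) :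
    ksEntropy μ T = ((entropyRate μ T P : ℝ) : EReal) := by
  let _ : MeasurableSpace ι := ⊤
  obtain ⟨f, hf, rfl⟩ := hP.exists_measurable
  refine le_antisymm (iSup_le fun k => iSup_le fun Q => iSup_le fun hQ => ?_) ?_
  · obtain ⟨g, hg, rfl⟩ := hQ.exists_measurable
    rw [EReal.coe_le_coe_iff]
    have hlim := (tendsto_entropyIncrement hT hf).add
      (hgen.tendsto_condMapEntropy hT.measurable hf hg)
    rw [add_zero] at hlim
    exact ge_of_tendsto' hlim fun N => entropyRate_le_increment_add_cond hT hg hf N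
  · let e := Fintype.equivFin ι
    have hef : Measurable (e ∘ f) := (measurable_of_finite e).comp hf
    have hpart : IsFinitePartition fun i => (e ∘ f) ⁻¹' {i} :=
      ⟨fun i => hef (measurableSet_singleton i),
        fun i j hij => Disjoint.preimage _ (Set.disjoint_singleton.2 hij),
        Set.eq_univ_of_forall fun ω => Set.mem_iUnion.2 ⟨e (f ω), rfl⟩⟩
    have hrate : entropyRate μ T (fun i => f ⁻¹' {i}) =
        entropyRate μ T fun i => (e ∘ f) ⁻¹' {i} := by
      have (n : ℕ) : mapEntropy μ (word T f n) = mapEntropy μ (word T (e ∘ f) n) :=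
        mapEntropy_congr fun ω ω' => by simp [word_eq_iff]
      rw [entropyRate_fiber hT.measurable hf, entropyRate_fiber hT.measurable hef]
      congr 1
      ext n
      simp only [entropyIncrement, this]
    rw [hrate]
    exact le_iSup_of_le _ (le_iSup_of_le _ (le_iSup_of_le hpart le_rfl))

/-! ### Markov partitions -/

/-- Under the Markov property the information gained from one further symbol is a function of the
last two symbols only, so by invariance all increments after the first one coincide. -/
theorem HasMarkovProperty.entropyRate_eq (hT : MeasurePreserving T μ μ) {P : ι → Set Ω}
    (hP : IsFinitePartition P) (hM : HasMarkovProperty μ T P) :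
    entropyRate μ T P = shannonEntropy μ (refinement T P 2) - shannonEntropy μ P := by
  let _ : MeasurableSpace ι := ⊤
  obtain ⟨f, hf, rfl⟩ := hP.exists_measurable
  have hw := fun n => measurable_word hT.measurable hf n
  set G : ι × ι → ℝ := fun x =>
    -Real.log (μ.real (f ⁻¹' {x.1} ∩ T ⁻¹' (f ⁻¹' {x.2})) / μ.real (f ⁻¹' {x.1})) with hG
  have hpair : Measurable fun ω => (f ω, f (T ω)) := hf.prodMk (hf.comp hT.measurable)
  have hinc (m : ℕ) : entropyIncrement μ T f (m + 1) = ∫ ω, G (f ω, f (T ω)) ∂μ := by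
    have hTm := hT.iterate m
    have hmap := integral_map (μ := μ) hTm.measurable.aemeasurable
      (f := fun ω => G (f ω, f (T ω))) (by
        rw [hTm.map_eq]; exact (integrable_comp_of_finite hpair G).aestronglyMeasurable)
    rw [hTm.map_eq] at hmap
    rw [hmap, entropyIncrement, mapEntropy, mapEntropy,
      ← integral_sub (integrable_information (hw _)) (integrable_information (hw _))]
    refine integral_congr_ae ?_
    filter_upwards [ae_measureReal_fiber_pos (μ := μ) (hw (m + 2)),
      ae_measureReal_fiber_pos (μ := μ) (hw (m + 1))] with ω h2 h1
    have hMω := hM m (word T f (m + 2) ω)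
    simp only [refinement_fiber] at hMω
    have hdiv : μ.real (word T f (m + 2) ⁻¹' {word T f (m + 2) ω}) /
        μ.real (word T f (m + 1) ⁻¹' {word T f (m + 1) ω}) =
        μ.real (f ⁻¹' {f (T^[m] ω)} ∩ T ⁻¹' (f ⁻¹' {f (T^[m + 1] ω)})) /
          μ.real (f ⁻¹' {f (T^[m] ω)}) := hMω h1
    rw [Function.iterate_succ_apply'] at hdiv
    simp only [hG]
    rw [← hdiv, Real.log_div h2.ne' h1.ne']
    ring
  have hlim : Tendsto (entropyIncrement μ T f) atTop (𝓝 (∫ ω, G (f ω, f (T ω)) ∂μ)) :=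
    (tendsto_add_atTop_iff_nat 1).1 (by simp only [hinc]; exact tendsto_const_nhds)
  have hone : mapEntropy μ f = mapEntropy μ (word T f 1) :=
    mapEntropy_congr fun ω ω' => by simp [word_eq_iff]
  rw [tendsto_nhds_unique (tendsto_entropyIncrement hT hf) hlim, ← hinc 0, refinement_fiber,
    shannonEntropy_fiber (hw 2), shannonEntropy_fiber hf, hone]
  rfl

end Partition

/-! ### Ordinal partitions -/

/-- Reading `π` backwards gives the stable sorting permutation of `x`. -/
theorem hasOrdinalPattern_iff {d : ℕ} (x : Fin (d + 1) → ℝ) (π : Equiv.Perm (Fin (d + 1))) :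
    HasOrdinalPattern x π ↔ Fin.revPerm.trans π = Tuple.sort x := by
  have hlex : HasOrdinalPattern x π ↔
      StrictAnti fun l => toLex (x (π l), π l) := by
    rw [Fin.strictAnti_iff_succ_lt]
    refine forall_congr' fun l => ?_
    rw [Prod.Lex.toLex_lt_toLex, ge_iff_le, le_iff_lt_or_eq]
    grind
  rw [hlex, Tuple.eq_sort_iff']
  refine ⟨fun h i j hij => ?_, fun h i j hij => ?_⟩
  · exact h (Fin.rev_lt_rev.2 hij)
  · have := h (Fin.rev_lt_rev.2 hij)
    simp only [Equiv.coe_trans, Function.comp_apply, Fin.revPerm_apply, Fin.rev_rev] at this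
    exact this

theorem existsUnique_hasOrdinalPattern {d : ℕ} (x : Fin (d + 1) → ℝ) :
    ∃! π, HasOrdinalPattern x π := by
  simp only [hasOrdinalPattern_iff]
  refine ⟨Fin.revPerm.trans (Tuple.sort x), by ext; simp, fun π hπ => ?_⟩
  rw [← hπ]
  ext; simp

theorem isFinitePartition_ordinalPartition [MeasurableSpace Ω] {T : Ω → Ω} (hT : Measurable T)
    {N : ℕ} {X : Ω → Fin N → ℝ} (hX : Measurable X) (d : ℕ) :
    IsFinitePartition (ordinalPartition T X d) where
  measurableSet π := by
    have hm (i : Fin N) (k : Fin (d + 1)) : Measurable fun ω => X (T^[d - (k : ℕ)] ω) i :=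
      (measurable_pi_apply i).comp (hX.comp (hT.iterate _))
    simp only [ordinalPartition, HasOrdinalPattern, Set.ofPred_forall]
    refine .iInter fun i => .iInter fun l => ?_
    exact (measurableSet_le (hm _ _) (hm _ _)).inter
      ((measurableSet_eq_fun (hm _ _) (hm _ _)).imp (.const _))
  disjoint π π' hne := by
    refine Set.disjoint_left.2 fun ω h h' => hne (funext fun i => ?_)
    exact (existsUnique_hasOrdinalPattern _).unique (h i) (h' i)
  iUnion_eq := by
    refine Set.eq_univ_of_forall fun ω => Set.mem_iUnion.2 ?_
    choose π hπ using fun i => (existsUnique_hasOrdinalPattern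
      fun k : Fin (d + 1) => X (T^[d - (k : ℕ)] ω) i).exists
    exact ⟨π, hπ⟩

end OrdinalEntropy

theorem mainTheorem5 {Ω : Type*} [TopologicalSpace Ω] [MeasurableSpace Ω] [BorelSpace Ω]
    (μ : Measure Ω) [IsProbabilityMeasure μ] (T : Ω → Ω) (hT : MeasurePreserving T μ μ)
    {N : ℕ} (X : Ω → Fin N → ℝ) (hX : Measurable X)
    (hrep : OrdinalEntropy.OrdinalRepresentation μ T X) :
    (∀ d₀ : ℕ,
      (∀ d ≥ d₀, OrdinalEntropy.HasMarkovProperty μ T (OrdinalEntropy.ordinalPartition T X d)) →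
      Tendsto (fun d : ℕ => ((OrdinalEntropy.condEntropy μ T X d : ℝ) : EReal)) atTop
        (𝓝 (OrdinalEntropy.ksEntropy μ T))) ∧
    (∀ d : ℕ,
      OrdinalEntropy.IsGenerating μ T (OrdinalEntropy.ordinalPartition T X d) →
      OrdinalEntropy.HasMarkovProperty μ T (OrdinalEntropy.ordinalPartition T X d) →
      OrdinalEntropy.ksEntropy μ T = ((OrdinalEntropy.condEntropy μ T X d : ℝ) : EReal)) := by
  have hpart := OrdinalEntropy.isFinitePartition_ordinalPartition hT.measurable hX
  have hrate (d : ℕ)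
      (hM : OrdinalEntropy.HasMarkovProperty μ T (OrdinalEntropy.ordinalPartition T X d)) :
      OrdinalEntropy.entropyRate μ T (OrdinalEntropy.ordinalPartition T X d) =
        OrdinalEntropy.condEntropy μ T X d := hM.entropyRate_eq hT (hpart d)
  refine ⟨fun d₀ hM => hrep.congr' ?_, fun d hgen hM => ?_⟩
  · filter_upwards [eventually_ge_atTop d₀] with d hd
    rw [hrate d (hM d hd)]
  · rw [hgen.ksEntropy_eq hT (hpart d), hrate d hM]
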